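/- Let $\mathbb D=\{z\in\mathbb C:|z|<1\}$, let $1/2<t<1$, and let $f(z)=z+\sum_{n\ge 2}a_nz^n$ be a bi-univalent function in $\mathbb D$: $f$ is analytic and univalent in $\mathbb D$, and its inverse $f^{-1}$, which is defined near the origin, extends to a function $g$ that is analytic and univalent in $\mathbb D$. For functions $F,G$ analytic in $\mathbb D$, write $F\prec G$ ($F$ is subordinate to $G$) if there is an analytic function $\omega:\mathbb D\to\mathbb D$ with $\omega(0)=0$ and $F=G\circ\omega$ on $\mathbb D$. Suppose that $f$ belongs to the class $\mathcal S^*_\sigma(t)$, that is, $$\frac{zf'(z)}{f(z)}\prec H(z,t)\qquad\text{and}\qquad \frac{wg'(w)}{g(w)}\prec H(w,t),\qquad\text{where } H(z,t)=\frac{1}{1-2tz+z^2},$$ both quotients taking the value $1$ at the origin. Then $$|a_2a_4-a_3^2|\le\begin{cases}\dfrac{8t^2}{3}, & \dfrac12<t\le\dfrac{7+\sqrt{401}}{44},\\[2ex] t^2+\dfrac{t\,(2+t-11t^2)^2}{3(22t^2-7t-4)}, & \dfrac{7+\sqrt{401}}{44}<t<1.\end{cases}$$ -/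

import Mathlib

open scoped Topology Nat

noncomputable section

namespace BiStarlike

/-- The open unit disk `𝔻 = {z ∈ ℂ : |z| < 1}`. -/
def unitDisk : Set ℂ := Metric.ball 0 1

/-- The class `𝒜`: functions analytic in the unit disk with `f(0) = 0` and `f'(0) = 1`.
Only the values of `f` on the disk matter. -/
def classA : Set (ℂ → ℂ) :=
  {f | AnalyticOnNhd ℂ f unitDisk ∧ f 0 = 0 ∧ deriv f 0 = 1}

/-- The class `𝒮`: the functions of `𝒜` that are univalent in the unit disk. -/
def classS : Set (ℂ → ℂ) :=
  {f | f ∈ classA ∧ Set.InjOn f unitDisk}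

/-- `g` is (the analytic continuation to the unit disk of) the inverse `f⁻¹`: it is analytic in the
disk and inverts `f` near the origin. On the disk such a `g` is unique, by the identity theorem. -/
def IsInverseInDisk (f g : ℂ → ℂ) : Prop :=
  AnalyticOnNhd ℂ g unitDisk ∧ ∀ᶠ z in 𝓝 (0 : ℂ), g (f z) = z

/-- The class `σ` of bi-univalent functions: `f ∈ 𝒮`, and `f⁻¹` is univalent in the disk too. -/
def classSigma : Set (ℂ → ℂ) :=
  {f | f ∈ classS ∧ ∃ g : ℂ → ℂ, IsInverseInDisk f g ∧ Set.InjOn g unitDisk}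

/-- Subordination `F ≺ G` in the unit disk: `F = G ∘ ω` on the disk for a Schwarz function `ω`. -/
def Subordinate (F G : ℂ → ℂ) : Prop :=
  ∃ ω : ℂ → ℂ, AnalyticOnNhd ℂ ω unitDisk ∧ ω 0 = 0 ∧ (∀ z ∈ unitDisk, ‖ω z‖ < 1) ∧
    ∀ z ∈ unitDisk, F z = G (ω z)

/-- `H(z, t) = 1 / (1 - 2tz + z²)`, the generating function of the Chebyshev polynomials of the
second kind. -/
def chebyshevH (t : ℝ) (z : ℂ) : ℂ := 1 / (1 - 2 * (t : ℂ) * z + z ^ 2)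

/-- The function `z f'(z) / f(z)`, with its removable singularity at `0` filled in by its limit,
which is `1` whenever `f(0) = 0` and `f'(0) ≠ 0`. -/
def starlikeQuotient (f : ℂ → ℂ) : ℂ → ℂ :=
  Function.update (fun z => z * deriv f z / f z) 0 1

/-- The class `𝒮*_σ(t)`: the `f ∈ σ` with `z f'(z)/f(z) ≺ H(·, t)` and `w g'(w)/g(w) ≺ H(·, t)`,
where `g = f⁻¹`. -/
def classStarSigma (t : ℝ) : Set (ℂ → ℂ) :=
  {f | f ∈ classSigma ∧ Subordinate (starlikeQuotient f) (chebyshevH t) ∧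
    ∃ g : ℂ → ℂ, IsInverseInDisk f g ∧ Subordinate (starlikeQuotient g) (chebyshevH t)}

/-- The `n`-th Taylor coefficient `aₙ` of `f` at the origin. -/
def taylorCoeff (f : ℂ → ℂ) (n : ℕ) : ℂ := iteratedDeriv n f 0 / (n ! : ℂ)

end BiStarlike

end

namespace BiStarlike

/-! The bound `8t²/3` holds on all of `1/2 < t ≤ 1` (`norm_hankel_le`), and past the threshold the
second expression is at least `8t²/3` (`hankel_bound_le`). Let `pᵢ`, `qᵢ` be the Taylor coefficients
of the Schwarz functions attached to `f` and to its inverse `g`. Comparing coefficients gives `a₂ =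
2tp₁`, `q₁ = -p₁`, `t(p₂ + q₂) = p₁²` and, with `d = (p₂ - q₂)/2`, `a₃ = 4t²p₁² + td`. Eliminating
`a₄` and `p₂ + q₂` leaves `a₂a₄ - a₃² = -(2/3)p₁⁴ + 2t³p₁²d - t²d² + (2t²/3)p₁(p₃ - q₃)`. Since
second and third coefficients of a Schwarz function are at most `1 - |p₁|²`
(`schwarz_coeff_bounds`), the triangle inequality reduces the claim to a one-variable polynomial
inequality in `|p₁|` (`hankel_majorant_le`). -/

/-! ### Calculus of Taylor coefficients at the origin. -/

lemma taylorCoeff_zero (f : ℂ → ℂ) : taylorCoeff f 0 = f 0 := by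
  simp [taylorCoeff]

lemma taylorCoeff_one (f : ℂ → ℂ) : taylorCoeff f 1 = deriv f 0 := by
  simp [taylorCoeff]

lemma taylorCoeff_congr {f g : ℂ → ℂ} (h : f =ᶠ[𝓝 0] g) (n : ℕ) :
    taylorCoeff f n = taylorCoeff g n := by
  simp only [taylorCoeff, (h.iteratedDeriv n).eq_of_nhds]

lemma taylorCoeff_add {f g : ℂ → ℂ} (hf : AnalyticAt ℂ f 0) (hg : AnalyticAt ℂ g 0) (n : ℕ) :
    taylorCoeff (fun z => f z + g z) n = taylorCoeff f n + taylorCoeff g n := by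
  simp only [taylorCoeff, iteratedDeriv_fun_add hf.contDiffAt hg.contDiffAt, add_div]

lemma taylorCoeff_sub {f g : ℂ → ℂ} (hf : AnalyticAt ℂ f 0) (hg : AnalyticAt ℂ g 0) (n : ℕ) :
    taylorCoeff (fun z => f z - g z) n = taylorCoeff f n - taylorCoeff g n := by
  simp only [taylorCoeff, iteratedDeriv_fun_sub hf.contDiffAt hg.contDiffAt, sub_div]

lemma taylorCoeff_const_mul (c : ℂ) {f : ℂ → ℂ} (hf : AnalyticAt ℂ f 0) (n : ℕ) :
    taylorCoeff (fun z => c * f z) n = c * taylorCoeff f n := by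
  simp only [taylorCoeff, iteratedDeriv_const_mul c hf.contDiffAt, mul_div_assoc]

lemma taylorCoeff_const (c : ℂ) (n : ℕ) :
    taylorCoeff (fun _ => c) n = if n = 0 then c else 0 := by
  rw [taylorCoeff, iteratedDeriv_const]
  split_ifs with h <;> simp [h]

lemma taylorCoeff_mul {f g : ℂ → ℂ} (hf : AnalyticAt ℂ f 0) (hg : AnalyticAt ℂ g 0) (n : ℕ) :
    taylorCoeff (fun z => f z * g z) n =
      ∑ i ∈ Finset.range (n + 1), taylorCoeff f i * taylorCoeff g (n - i) := by
  rw [taylorCoeff, iteratedDeriv_fun_mul hf.contDiffAt hg.contDiffAt, Finset.sum_div]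
  refine Finset.sum_congr rfl fun i hi => ?_
  have hi : i ≤ n := by simpa [Nat.lt_succ_iff] using hi
  rw [taylorCoeff, taylorCoeff, Nat.cast_choose ℂ hi]
  have := Nat.cast_ne_zero (R := ℂ).2 n.factorial_ne_zero
  field_simp

lemma taylorCoeff_deriv (f : ℂ → ℂ) (n : ℕ) :
    taylorCoeff (deriv f) n = (n + 1) * taylorCoeff f (n + 1) := by
  rw [taylorCoeff, taylorCoeff, iteratedDeriv_succ', Nat.factorial_succ]
  push_cast
  have := Nat.cast_ne_zero (R := ℂ).2 n.factorial_ne_zero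
  have : (n : ℂ) + 1 ≠ 0 := by exact_mod_cast n.succ_ne_zero
  field_simp

lemma taylorCoeff_id_mul_succ {f : ℂ → ℂ} (hf : AnalyticAt ℂ f 0) (n : ℕ) :
    taylorCoeff (fun z => z * f z) (n + 1) = taylorCoeff f n := by
  rw [taylorCoeff_mul (f := fun z => z) analyticAt_id hf, Finset.sum_eq_single 1]
  · simp [taylorCoeff_one]
  · intro i _ hi
    rcases i with _ | i
    · simp [taylorCoeff_zero]
    · have hi : i ≠ 0 := by simpa using hi
      have : taylorCoeff (fun z : ℂ => z) (i + 1) = 0 := by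
        simp [taylorCoeff, iteratedDeriv_succ', iteratedDeriv_const, hi]
      simp [this]
  · simp

lemma analyticAt_dslope {f : ℂ → ℂ} (hf : AnalyticAt ℂ f 0) : AnalyticAt ℂ (dslope f 0) 0 :=
  let ⟨_, hp⟩ := hf
  ⟨_, hp.has_fpower_series_dslope_fslope⟩

lemma eq_add_mul_dslope (f : ℂ → ℂ) (z : ℂ) : f z = f 0 + z * dslope f 0 z := by
  have := sub_smul_dslope f 0 z
  simp only [sub_zero, smul_eq_mul] at this
  rw [this]; ring

lemma taylorCoeff_dslope {f : ℂ → ℂ} (hf : AnalyticAt ℂ f 0) (n : ℕ) :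
    taylorCoeff (dslope f 0) n = taylorCoeff f (n + 1) := by
  have hd := analyticAt_dslope hf
  rw [taylorCoeff_congr (Filter.Eventually.of_forall (eq_add_mul_dslope f)) (n + 1),
    taylorCoeff_add analyticAt_const (AnalyticAt.fun_mul (f := fun z => z) analyticAt_id hd), taylorCoeff_id_mul_succ hd,
    taylorCoeff_const]
  simp

/-- Comes from `u ∘ f = u 0 + f · (dslope u 0 ∘ f)`. As `f 0 = 0`, the term `i = 0` vanishes, so
this is a recursion on the order of the coefficient. -/
lemma taylorCoeff_comp {u f : ℂ → ℂ} (hu : AnalyticAt ℂ u 0) (hf : AnalyticAt ℂ f 0)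
    (h0 : f 0 = 0) (n : ℕ) :
    taylorCoeff (fun z => u (f z)) (n + 1) = ∑ i ∈ Finset.range (n + 2),
      taylorCoeff f i * taylorCoeff (fun z => dslope u 0 (f z)) (n + 1 - i) := by
  have hd : AnalyticAt ℂ (fun z => dslope u 0 (f z)) 0 :=
    AnalyticAt.fun_comp (by simpa [h0] using analyticAt_dslope hu) hf
  rw [taylorCoeff_congr (Filter.Eventually.of_forall fun z => eq_add_mul_dslope u (f z)) (n + 1),
    taylorCoeff_add analyticAt_const (hf.fun_mul hd), taylorCoeff_mul hf hd, taylorCoeff_const]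
  simp

lemma taylorCoeff_comp_one {u f : ℂ → ℂ} (hu : AnalyticAt ℂ u 0) (hf : AnalyticAt ℂ f 0)
    (h0 : f 0 = 0) :
    taylorCoeff (fun z => u (f z)) 1 = taylorCoeff u 1 * taylorCoeff f 1 := by
  rw [taylorCoeff_comp hu hf h0]
  simp [Finset.sum_range_succ, taylorCoeff_zero, h0, taylorCoeff_one, mul_comm]

lemma taylorCoeff_comp_two {u f : ℂ → ℂ} (hu : AnalyticAt ℂ u 0) (hf : AnalyticAt ℂ f 0)
    (h0 : f 0 = 0) :
    taylorCoeff (fun z => u (f z)) 2 =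
      taylorCoeff u 1 * taylorCoeff f 2 + taylorCoeff u 2 * taylorCoeff f 1 ^ 2 := by
  have h1 := taylorCoeff_comp_one (analyticAt_dslope hu) hf h0
  have h := taylorCoeff_dslope hu 0
  rw [taylorCoeff_zero] at h
  rw [taylorCoeff_comp hu hf h0]
  norm_num [Finset.sum_range_succ, h1, taylorCoeff_dslope hu, taylorCoeff_zero, h0, h]
  simp only [← taylorCoeff_one]
  ring

lemma taylorCoeff_comp_three {u f : ℂ → ℂ} (hu : AnalyticAt ℂ u 0) (hf : AnalyticAt ℂ f 0)
    (h0 : f 0 = 0) :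
    taylorCoeff (fun z => u (f z)) 3 =
      taylorCoeff u 1 * taylorCoeff f 3 + 2 * taylorCoeff u 2 * taylorCoeff f 1 * taylorCoeff f 2
        + taylorCoeff u 3 * taylorCoeff f 1 ^ 3 := by
  have h1 := taylorCoeff_comp_one (analyticAt_dslope hu) hf h0
  have h2 := taylorCoeff_comp_two (analyticAt_dslope hu) hf h0
  have h := taylorCoeff_dslope hu 0
  rw [taylorCoeff_zero] at h
  rw [taylorCoeff_comp hu hf h0]
  norm_num [Finset.sum_range_succ, h1, h2, taylorCoeff_dslope hu, taylorCoeff_zero, h0, h]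
  simp only [← taylorCoeff_one]
  ring

lemma taylorCoeff_comp_four {u f : ℂ → ℂ} (hu : AnalyticAt ℂ u 0) (hf : AnalyticAt ℂ f 0)
    (h0 : f 0 = 0) :
    taylorCoeff (fun z => u (f z)) 4 =
      taylorCoeff u 1 * taylorCoeff f 4
        + taylorCoeff u 2 * (2 * taylorCoeff f 1 * taylorCoeff f 3 + taylorCoeff f 2 ^ 2)
        + 3 * taylorCoeff u 3 * taylorCoeff f 1 ^ 2 * taylorCoeff f 2
        + taylorCoeff u 4 * taylorCoeff f 1 ^ 4 := by
  have h1 := taylorCoeff_comp_one (analyticAt_dslope hu) hf h0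
  have h2 := taylorCoeff_comp_two (analyticAt_dslope hu) hf h0
  have h3 := taylorCoeff_comp_three (analyticAt_dslope hu) hf h0
  have h := taylorCoeff_dslope hu 0
  rw [taylorCoeff_zero] at h
  rw [taylorCoeff_comp hu hf h0]
  norm_num [Finset.sum_range_succ, h1, h2, h3, taylorCoeff_dslope hu, taylorCoeff_zero, h0, h]
  simp only [← taylorCoeff_one]
  ring

/-! ### Coefficient bounds for bounded functions and Schwarz functions. -/

/-- Cauchy's estimate for functions bounded by one in the unit disk. -/
lemma norm_taylorCoeff_le_one {f : ℂ → ℂ} (hf : DifferentiableOn ℂ f unitDisk)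
    (hb : ∀ z ∈ unitDisk, ‖f z‖ ≤ 1) (n : ℕ) : ‖taylorCoeff f n‖ ≤ 1 := by
  have key : ∀ r ∈ Set.Ioo (0 : ℝ) 1, ‖taylorCoeff f n‖ * r ^ n ≤ 1 := by
    intro r hr
    have hsub : Metric.closedBall (0 : ℂ) r ⊆ unitDisk := Metric.closedBall_subset_ball hr.2
    have h := Complex.norm_iteratedDeriv_le_of_forall_mem_sphere_norm_le (f := f) (c := 0) n hr.1
      ((hf.mono hsub).diffContOnCl_ball le_rfl) fun z hz =>
        hb z (hsub (Metric.sphere_subset_closedBall hz))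
    have hn : (0 : ℝ) < n ! := by exact_mod_cast n.factorial_pos
    rw [taylorCoeff, norm_div, Complex.norm_natCast]
    have hr' : 0 < r ^ n := pow_pos hr.1 n
    rw [mul_one, le_div_iff₀ hr'] at h
    rw [div_mul_eq_mul_div, div_le_one hn]
    exact h
  have hlim : Filter.Tendsto (fun r : ℝ => ‖taylorCoeff f n‖ * r ^ n) (𝓝[<] 1)
      (𝓝 (‖taylorCoeff f n‖ * 1 ^ n)) :=
    ((continuous_const.mul (continuous_pow n)).tendsto 1).mono_left nhdsWithin_le_nhds
  rw [one_pow, mul_one] at hlim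
  exact le_of_tendsto hlim
    (Filter.eventually_of_mem (Ioo_mem_nhdsLT one_pos) key)

lemma zero_mem_unitDisk : (0 : ℂ) ∈ unitDisk := by simp [unitDisk]

lemma isOpen_unitDisk : IsOpen unitDisk := Metric.isOpen_ball

lemma analyticAt_zero_of_differentiableOn {f : ℂ → ℂ} (hf : DifferentiableOn ℂ f unitDisk) :
    AnalyticAt ℂ f 0 :=
  hf.analyticAt (isOpen_unitDisk.mem_nhds zero_mem_unitDisk)

/-- The squares of the two sides differ by `(1 - |a|²)(1 - |w|²)`. -/
lemma norm_sub_le_norm_one_sub_conj_mul {a w : ℂ} (ha : ‖a‖ ≤ 1) (hw : ‖w‖ ≤ 1) :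
    ‖w - a‖ ≤ ‖1 - starRingEnd ℂ a * w‖ := by
  rw [← sq_le_sq₀ (norm_nonneg _) (norm_nonneg _)]
  have ha' : ‖a‖ ^ 2 ≤ 1 := pow_le_one₀ (norm_nonneg _) ha
  have hw' : ‖w‖ ^ 2 ≤ 1 := pow_le_one₀ (norm_nonneg _) hw
  simp only [Complex.sq_norm, Complex.normSq_apply] at *
  simp
  nlinarith [mul_nonneg (sub_nonneg.2 ha') (sub_nonneg.2 hw')]

/-- Schwarz–Pick at the origin, by Cauchy's estimate for a Möbius transform of `f`. -/
lemma norm_taylorCoeff_le_of_norm_lt_one {f : ℂ → ℂ} (hf : DifferentiableOn ℂ f unitDisk)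
    (hb : ∀ z ∈ unitDisk, ‖f z‖ ≤ 1) (h0 : ‖f 0‖ < 1) :
    ‖taylorCoeff f 1‖ ≤ 1 - ‖f 0‖ ^ 2 ∧
      (taylorCoeff f 1 = 0 → ‖taylorCoeff f 2‖ ≤ 1 - ‖f 0‖ ^ 2) := by
  set a := f 0 with ha
  have hne : ∀ z ∈ unitDisk, 1 - starRingEnd ℂ a * f z ≠ 0 := by
    intro z hz h
    have : ‖starRingEnd ℂ a * f z‖ < 1 := by
      rw [norm_mul, RCLike.norm_conj]
      nlinarith [norm_nonneg a, norm_nonneg (f z), hb z hz]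
    rw [← sub_eq_zero.1 h] at this
    simp at this
  set χ : ℂ → ℂ := fun z => (f z - a) / (1 - starRingEnd ℂ a * f z) with hχ
  have hχd : DifferentiableOn ℂ χ unitDisk :=
    (hf.sub_const a).div ((hf.const_mul _).const_sub 1) hne
  have hχb : ∀ z ∈ unitDisk, ‖χ z‖ ≤ 1 := fun z hz => by
    rw [hχ, norm_div]
    exact div_le_one_of_le₀ (norm_sub_le_norm_one_sub_conj_mul h0.le (hb z hz)) (norm_nonneg _)
  have hfa := analyticAt_zero_of_differentiableOn hf
  have hχa := analyticAt_zero_of_differentiableOn hχd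
  have hda : AnalyticAt ℂ (fun z => 1 - starRingEnd ℂ a * f z) 0 :=
    analyticAt_const.fun_sub (analyticAt_const.fun_mul hfa)
  have heq : (fun z => χ z * (1 - starRingEnd ℂ a * f z)) =ᶠ[𝓝 0] fun z => f z - a := by
    filter_upwards [isOpen_unitDisk.mem_nhds zero_mem_unitDisk] with z hz
    exact div_mul_cancel₀ _ (hne z hz)
  have hcoeff : ∀ n, taylorCoeff (fun z => χ z * (1 - starRingEnd ℂ a * f z)) n =
      taylorCoeff f n - if n = 0 then a else 0 := fun n => by
    rw [taylorCoeff_congr heq, taylorCoeff_sub hfa analyticAt_const, taylorCoeff_const]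
  have hden : ∀ n, taylorCoeff (fun z => 1 - starRingEnd ℂ a * f z) n =
      (if n = 0 then 1 else 0) - starRingEnd ℂ a * taylorCoeff f n := fun n => by
    rw [taylorCoeff_sub analyticAt_const (analyticAt_const.fun_mul hfa), taylorCoeff_const,
      taylorCoeff_const_mul _ hfa]
  have hχ0 : taylorCoeff χ 0 = 0 := by simp [taylorCoeff_zero, hχ, ha]
  have hf0 : taylorCoeff f 0 = a := taylorCoeff_zero f
  have h1 := hcoeff 1
  have h2 := hcoeff 2
  simp only [taylorCoeff_mul hχa hda, hden, Finset.sum_range_succ, Finset.sum_range_zero] at h1 h2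
  norm_num [hχ0, hf0] at h1 h2
  have hpos : 0 < 1 - ‖a‖ ^ 2 := by nlinarith [norm_nonneg a]
  have hnorm : ‖1 - starRingEnd ℂ a * a‖ = 1 - ‖a‖ ^ 2 := by
    rw [Complex.conj_mul', ← Complex.ofReal_pow, ← Complex.ofReal_one, ← Complex.ofReal_sub,
      Complex.norm_real, Real.norm_of_nonneg hpos.le]
  constructor
  · rw [← h1, norm_mul, hnorm]
    exact mul_le_of_le_one_left hpos.le (norm_taylorCoeff_le_one hχd hχb 1)
  -- With vanishing first coefficient, the cross term in the second coefficient of `χ · (1 - ā f) =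
  -- f - a` drops out.
  · intro hz
    rw [hz] at h2
    simp only [mul_zero, neg_zero, zero_add] at h2
    rw [← h2, norm_mul, hnorm]
    exact mul_le_of_le_one_left hpos.le (norm_taylorCoeff_le_one hχd hχb 2)

/-- The case `|f 0| = 1` is reached by applying the strict version to `r f` and letting `r → 1`. -/
lemma norm_taylorCoeff_le_one_sub_sq {f : ℂ → ℂ} (hf : DifferentiableOn ℂ f unitDisk)
    (hb : ∀ z ∈ unitDisk, ‖f z‖ ≤ 1) :
    ‖taylorCoeff f 1‖ ≤ 1 - ‖f 0‖ ^ 2 ∧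
      (taylorCoeff f 1 = 0 → ‖taylorCoeff f 2‖ ≤ 1 - ‖f 0‖ ^ 2) := by
  have hfa := analyticAt_zero_of_differentiableOn hf
  have key : ∀ r ∈ Set.Ioo (0 : ℝ) 1, r * ‖taylorCoeff f 1‖ ≤ 1 - (r * ‖f 0‖) ^ 2 ∧
      (taylorCoeff f 1 = 0 → r * ‖taylorCoeff f 2‖ ≤ 1 - (r * ‖f 0‖) ^ 2) := by
    intro r hr
    have hrn : ‖(r : ℂ)‖ = r := by rw [Complex.norm_real, Real.norm_of_nonneg hr.1.le]
    have hlt : ∀ z ∈ unitDisk, ‖(r : ℂ) * f z‖ < 1 := fun z hz => by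
      rw [norm_mul, hrn]
      nlinarith [hr.1, hr.2, hb z hz, norm_nonneg (f z)]
    have := norm_taylorCoeff_le_of_norm_lt_one (hf.const_mul (r : ℂ)) (fun z hz => (hlt z hz).le)
      (hlt 0 zero_mem_unitDisk)
    simp only [taylorCoeff_const_mul _ hfa, norm_mul, hrn, mul_eq_zero] at this
    exact ⟨this.1, fun h => this.2 (Or.inr h)⟩
  have hmem := Ioo_mem_nhdsLT (zero_lt_one (α := ℝ))
  have lim : ∀ c : ℝ, (∀ r ∈ Set.Ioo (0 : ℝ) 1, r * c ≤ 1 - (r * ‖f 0‖) ^ 2) →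
      c ≤ 1 - ‖f 0‖ ^ 2 := by
    intro c h
    have h1 : Filter.Tendsto (fun r : ℝ => r * c) (𝓝[<] 1) (𝓝 (1 * c)) :=
      (Continuous.tendsto (by fun_prop) 1).mono_left nhdsWithin_le_nhds
    have h2 : Filter.Tendsto (fun r : ℝ => 1 - (r * ‖f 0‖) ^ 2) (𝓝[<] 1)
        (𝓝 (1 - (1 * ‖f 0‖) ^ 2)) :=
      (Continuous.tendsto (by fun_prop) 1).mono_left nhdsWithin_le_nhds
    simpa using le_of_tendsto_of_tendsto h1 h2 (Filter.eventually_of_mem hmem h)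
  exact ⟨lim _ fun r hr => (key r hr).1, fun h => lim _ fun r hr => (key r hr).2 h⟩

/-- The even part of `f` has the same value at `0` and the same second coefficient, is still bounded
by one, and has zero first coefficient. -/
lemma norm_taylorCoeff_two_le {f : ℂ → ℂ} (hf : DifferentiableOn ℂ f unitDisk)
    (hb : ∀ z ∈ unitDisk, ‖f z‖ ≤ 1) : ‖taylorCoeff f 2‖ ≤ 1 - ‖f 0‖ ^ 2 := by
  have hneg : ∀ z ∈ unitDisk, -z ∈ unitDisk := fun z hz => by simpa [unitDisk] using hz
  have hfn : DifferentiableOn ℂ (fun z => f (-z)) unitDisk :=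
    hf.fun_comp (differentiableOn_neg _) hneg
  have hfa := analyticAt_zero_of_differentiableOn hf
  have hna := analyticAt_zero_of_differentiableOn hfn
  have hcn : ∀ n, taylorCoeff (fun z => f (-z)) n = (-1) ^ n * taylorCoeff f n := fun n => by
    simp only [taylorCoeff, iteratedDeriv_comp_neg, neg_zero, smul_eq_mul, mul_div_assoc]
  have hc : ∀ n, taylorCoeff (fun z => 1 / 2 * (f z + f (-z))) n =
      1 / 2 * (taylorCoeff f n + (-1) ^ n * taylorCoeff f n) := fun n => by
    rw [taylorCoeff_const_mul _ (hfa.fun_add hna), taylorCoeff_add hfa hna, hcn]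
  have h := (norm_taylorCoeff_le_one_sub_sq ((hf.fun_add hfn).const_mul (1 / 2)) fun z hz => by
    rw [norm_mul]
    have := norm_add_le (f z) (f (-z))
    have := hb z hz
    have := hb _ (hneg z hz)
    norm_num
    linarith).2 (by rw [hc]; ring)
  rw [hc] at h
  convert h using 2
  · ring
  · congr 2; simp; ring

/-- Coefficient bounds for a Schwarz function. -/
lemma schwarz_coeff_bounds {ω : ℂ → ℂ} (hω : AnalyticOnNhd ℂ ω unitDisk) (h0 : ω 0 = 0)
    (hb : ∀ z ∈ unitDisk, ‖ω z‖ < 1) :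
    ‖taylorCoeff ω 1‖ ≤ 1 ∧ ‖taylorCoeff ω 2‖ ≤ 1 - ‖taylorCoeff ω 1‖ ^ 2 ∧
      ‖taylorCoeff ω 3‖ ≤ 1 - ‖taylorCoeff ω 1‖ ^ 2 := by
  -- By the Schwarz lemma `ω(z)/z` is bounded by one; its coefficients are those of `ω` shifted by
  -- one.
  have hd : DifferentiableOn ℂ (dslope ω 0) unitDisk :=
    (Complex.differentiableOn_dslope (isOpen_unitDisk.mem_nhds zero_mem_unitDisk)).2
      hω.differentiableOn
  have hφ : ∀ z ∈ unitDisk, ‖dslope ω 0 z‖ ≤ 1 := fun z hz => by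
    simpa using Complex.norm_dslope_le_div_of_mapsTo_ball (R₁ := 1) (R₂ := 1)
      hω.differentiableOn (fun z hz => by simpa [h0] using (hb z hz).le) hz
  have hωa := hω 0 zero_mem_unitDisk
  rw [← taylorCoeff_dslope hωa 0, ← taylorCoeff_dslope hωa 1, ← taylorCoeff_dslope hωa 2,
    taylorCoeff_zero]
  exact ⟨hφ 0 zero_mem_unitDisk, (norm_taylorCoeff_le_one_sub_sq hd hφ).1,
    norm_taylorCoeff_two_le hd hφ⟩

/-! ### Coefficient relations for `f` and its inverse. -/

/-- The first Taylor coefficients of a function whose starlike quotient is subordinate to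
`chebyshevH t`, in terms of those of the Schwarz function. -/
lemma coeff_relations_of_subordinate {t : ℝ} {f : ℂ → ℂ} (hf : AnalyticAt ℂ f 0) (h0 : f 0 = 0)
    (h1 : deriv f 0 = 1) (hsub : Subordinate (starlikeQuotient f) (chebyshevH t)) :
    ∃ p₁ p₂ p₃ : ℂ, (‖p₁‖ ≤ 1 ∧ ‖p₂‖ ≤ 1 - ‖p₁‖ ^ 2 ∧ ‖p₃‖ ≤ 1 - ‖p₁‖ ^ 2) ∧
      taylorCoeff f 2 = 2 * t * p₁ ∧
      2 * taylorCoeff f 3 = 2 * t * p₂ - p₁ ^ 2 + 4 * t * p₁ * taylorCoeff f 2 ∧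
      3 * taylorCoeff f 4 = 2 * t * p₃ - 2 * p₁ * p₂ + 2 * taylorCoeff f 2 * (2 * t * p₂ - p₁ ^ 2)
        + 6 * t * p₁ * taylorCoeff f 3 := by
  obtain ⟨ω, hω, hω0, hωb, hωeq⟩ := hsub
  refine ⟨_, _, _, schwarz_coeff_bounds hω hω0 hωb, ?_⟩
  have hωa := hω 0 zero_mem_unitDisk
  set D : ℂ → ℂ := fun z => 1 - 2 * (t : ℂ) * ω z + ω z * ω z with hD
  have hDl : AnalyticAt ℂ (fun z => 2 * (t : ℂ) * ω z) 0 := analyticAt_const.fun_mul hωa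
  have hDs : AnalyticAt ℂ (fun z => 1 - 2 * (t : ℂ) * ω z) 0 := analyticAt_const.fun_sub hDl
  have hDa : AnalyticAt ℂ D 0 := hDs.fun_add (hωa.fun_mul hωa)
  have hD0 : D 0 = 1 := by simp [hD, hω0]
  have hDne : ∀ᶠ z in 𝓝 (0 : ℂ), D z ≠ 0 :=
    hDa.continuousAt.eventually_ne (by simp [hD0])
  have hfne : ∀ᶠ z in 𝓝 (0 : ℂ), z ≠ 0 → f z ≠ 0 := by
    have : ∀ᶠ z in 𝓝 (0 : ℂ), dslope f 0 z ≠ 0 :=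
      (analyticAt_dslope hf).continuousAt.eventually_ne (by simp [h1])
    filter_upwards [this] with z hz hz0
    rw [eq_add_mul_dslope f z, h0, zero_add]
    exact mul_ne_zero hz0 hz
  -- Clearing both denominators turns the subordination into `z f' D = f`, to be compared
  -- coefficient by coefficient.
  have heq : (fun z => z * (deriv f z * D z)) =ᶠ[𝓝 0] f := by
    filter_upwards [hDne, hfne, isOpen_unitDisk.mem_nhds zero_mem_unitDisk] with z hDz hfz hz
    rcases eq_or_ne z 0 with rfl | hz0
    · simp [h0]
    · have h := hωeq z hz
      have hD' : D z = 1 - 2 * (t : ℂ) * ω z + ω z ^ 2 := by rw [hD]; ring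
      rw [starlikeQuotient, Function.update_of_ne hz0, chebyshevH, ← hD',
        div_eq_div_iff (hfz hz0) hDz] at h
      linear_combination h
  have hda : AnalyticAt ℂ (deriv f) 0 := hf.deriv
  have hcoeff : ∀ n, ∑ i ∈ Finset.range (n + 1), (i + 1) * taylorCoeff f (i + 1) *
      taylorCoeff D (n - i) = taylorCoeff f (n + 1) := fun n => by
    rw [← taylorCoeff_congr heq, taylorCoeff_id_mul_succ (hda.fun_mul hDa), taylorCoeff_mul hda hDa]
    simp only [taylorCoeff_deriv]
  have hDc : ∀ n, taylorCoeff D (n + 1) = -(2 * t * taylorCoeff ω (n + 1)) +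
      ∑ i ∈ Finset.range (n + 2), taylorCoeff ω i * taylorCoeff ω (n + 1 - i) := fun n => by
    rw [hD, taylorCoeff_add hDs (hωa.fun_mul hωa), taylorCoeff_mul hωa hωa,
      taylorCoeff_sub analyticAt_const hDl, taylorCoeff_const, taylorCoeff_const_mul _ hωa]
    simp
  have c0 : taylorCoeff ω 0 = 0 := by rw [taylorCoeff_zero, hω0]
  have d0 : taylorCoeff D 0 = 1 := by rw [taylorCoeff_zero, hD0]
  have a1 : taylorCoeff f 1 = 1 := by rw [taylorCoeff_one, h1]
  have d1 := hDc 0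
  have d2 := hDc 1
  have d3 := hDc 2
  have e1 := hcoeff 1
  have e2 := hcoeff 2
  have e3 := hcoeff 3
  simp only [Finset.sum_range_succ, Finset.sum_range_zero] at d1 d2 d3 e1 e2 e3
  norm_num [c0, d0, a1] at d1 d2 d3 e1 e2 e3
  rw [d1] at e1
  rw [d1, d2] at e2
  rw [d1, d2, d3] at e3
  refine ⟨?_, ?_, ?_⟩
  · linear_combination e1
  · linear_combination e2
  · linear_combination e3

/-- The first Taylor coefficients of the inverse of a normalized function. -/
lemma taylorCoeff_inverse {f g : ℂ → ℂ} (hf : AnalyticAt ℂ f 0) (h0 : f 0 = 0)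
    (h1 : deriv f 0 = 1) (hg : AnalyticAt ℂ g 0) (hgf : ∀ᶠ z in 𝓝 (0 : ℂ), g (f z) = z) :
    deriv g 0 = 1 ∧ taylorCoeff g 2 = -taylorCoeff f 2 ∧
      taylorCoeff g 3 = 2 * taylorCoeff f 2 ^ 2 - taylorCoeff f 3 ∧
      taylorCoeff g 4 =
        -5 * taylorCoeff f 2 ^ 3 + 5 * taylorCoeff f 2 * taylorCoeff f 3 - taylorCoeff f 4 := by
  have hid : ∀ n, taylorCoeff (fun z => g (f z)) (n + 1) = if n = 0 then 1 else 0 := fun n => by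
    have : (fun z => g (f z)) =ᶠ[𝓝 0] fun z => z * (fun _ => 1) z := by
      filter_upwards [hgf] with z hz
      rw [hz, mul_one]
    rw [taylorCoeff_congr this, taylorCoeff_id_mul_succ analyticAt_const, taylorCoeff_const]
  have a1 : taylorCoeff f 1 = 1 := by rw [taylorCoeff_one, h1]
  have e1 := hid 0
  have e2 := hid 1
  have e3 := hid 2
  have e4 := hid 3
  norm_num [taylorCoeff_comp_one hg hf h0, taylorCoeff_comp_two hg hf h0,
    taylorCoeff_comp_three hg hf h0, taylorCoeff_comp_four hg hf h0, a1] at e1 e2 e3 e4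
  simp only [e1, one_mul] at e2 e3 e4
  have b2 : taylorCoeff g 2 = -taylorCoeff f 2 := by linear_combination e2
  rw [b2] at e3 e4
  have b3 : taylorCoeff g 3 = 2 * taylorCoeff f 2 ^ 2 - taylorCoeff f 3 := by
    linear_combination e3
  rw [b3] at e4
  refine ⟨by rw [← taylorCoeff_one, e1], b2, b3, ?_⟩
  linear_combination e4

/-! ### Estimating the Hankel determinant. -/

lemma hankel_majorant_le {t r s d : ℝ} (ht : 1 / 2 < t) (ht1 : t ≤ 1) (hr : 0 ≤ r) (hr1 : r ≤ 1)
    (hd0 : 0 ≤ d) (hd : d ≤ 1 - r ^ 2) (hs : s ≤ 2 * (1 - r ^ 2)) :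
    2 / 3 * r ^ 4 + 2 * t ^ 3 * r ^ 2 * d + t ^ 2 * d ^ 2 + 2 * t ^ 2 / 3 * r * s
      ≤ 8 * t ^ 2 / 3 := by
  have hu : 0 ≤ 1 - r ^ 2 := by nlinarith
  have h1 : 2 / 3 * r ^ 4 ≤ t ^ 2 * (8 / 3 * r ^ 4) := by
    nlinarith [mul_nonneg (by nlinarith : 0 ≤ t ^ 2 - 1 / 4) (by positivity : 0 ≤ r ^ 4)]
  have h2 : 2 * t ^ 3 * r ^ 2 * d ≤ t ^ 2 * (2 * r ^ 2 * (1 - r ^ 2)) := by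
    have : t * d ≤ 1 - r ^ 2 := by nlinarith
    nlinarith [mul_nonneg (by positivity : 0 ≤ 2 * t ^ 2 * r ^ 2) (sub_nonneg.2 this)]
  have h3 : t ^ 2 * d ^ 2 ≤ t ^ 2 * (1 - r ^ 2) ^ 2 := by gcongr
  have h4 : 2 * t ^ 2 / 3 * r * s ≤ t ^ 2 * (4 / 3 * r * (1 - r ^ 2)) := by
    nlinarith [mul_nonneg (by positivity : 0 ≤ 2 * t ^ 2 / 3 * r) (sub_nonneg.2 hs)]
  -- The gap is `(1 - r²)(5(1 + r²) - 4r)/3`, which vanishes at `r = 1`.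
  have h5 : 8 / 3 * r ^ 4 + 2 * r ^ 2 * (1 - r ^ 2) + (1 - r ^ 2) ^ 2 + 4 / 3 * r * (1 - r ^ 2)
      ≤ 8 / 3 := by
    nlinarith [mul_nonneg hu (by nlinarith : 0 ≤ 5 * (1 + r ^ 2) - 4 * r)]
  nlinarith [mul_le_mul_of_nonneg_left h5 (sq_nonneg t)]

/-- A bound for the second Hankel determinant, valid for every `1 / 2 < t ≤ 1`. -/
theorem norm_hankel_le {t : ℝ} (ht : 1 / 2 < t) (ht1 : t ≤ 1) {f : ℂ → ℂ}
    (hf : f ∈ classStarSigma t) :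
    ‖taylorCoeff f 2 * taylorCoeff f 4 - taylorCoeff f 3 ^ 2‖ ≤ 8 * t ^ 2 / 3 := by
  obtain ⟨⟨⟨⟨hfa, h0, h1⟩, -⟩, -⟩, hsubf, g, ⟨hga, hgf⟩, hsubg⟩ := hf
  have hfa := hfa 0 zero_mem_unitDisk
  have hga := hga 0 zero_mem_unitDisk
  have hg0 : g 0 = 0 := by simpa [h0] using hgf.self_of_nhds
  obtain ⟨hg1, b2, b3, b4⟩ := taylorCoeff_inverse hfa h0 h1 hga hgf
  obtain ⟨p₁, p₂, p₃, ⟨hp1, hp2, hp3⟩, e1, e2, e3⟩ := coeff_relations_of_subordinate hfa h0 h1 hsubf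
  obtain ⟨q₁, q₂, q₃, ⟨-, hq2, hq3⟩, f1, f2, f3⟩ := coeff_relations_of_subordinate hga hg0 hg1 hsubg
  have htc : (t : ℂ) ≠ 0 := by
    exact_mod_cast (by linarith : t ≠ 0)
  have hq : q₁ = -p₁ := by
    have : (2 * t : ℂ) * (q₁ + p₁) = 0 := by linear_combination b2 - f1 - e1
    have := (mul_eq_zero.1 this).resolve_left (by simpa using htc)
    linear_combination this
  subst hq
  rw [norm_neg] at hq2 hq3
  rw [b2, b3] at f2
  rw [b2, b3, b4] at f3
  -- Sum and difference of the two third-coefficient relations give `hsum` and `ha3`.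
  have hsum : (t : ℂ) * (p₂ + q₂) = p₁ ^ 2 := by
    rw [e1] at e2 f2
    linear_combination (-e2 - f2) / 2
  have ha3 : taylorCoeff f 3 = 4 * t ^ 2 * p₁ ^ 2 + t * ((p₂ - q₂) / 2) := by
    rw [e1] at e2 f2
    linear_combination (e2 - f2) / 4
  have hE : taylorCoeff f 2 * taylorCoeff f 4 - taylorCoeff f 3 ^ 2 =
      -(2 / 3 * p₁ ^ 4) + 2 * t ^ 3 * p₁ ^ 2 * ((p₂ - q₂) / 2) - t ^ 2 * ((p₂ - q₂) / 2) ^ 2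
        + 2 * t ^ 2 / 3 * p₁ * (p₃ - q₃) := by
    rw [e1, ha3] at e3 f3
    rw [e1, ha3]
    linear_combination (t / 3 : ℂ) * p₁ * (e3 - f3) + (8 / 3 * t ^ 2 - 2 / 3) * p₁ ^ 2 * hsum
  have hd : ‖(p₂ - q₂) / 2‖ ≤ 1 - ‖p₁‖ ^ 2 := by
    rw [norm_div, Complex.norm_two]
    linarith [norm_sub_le p₂ q₂]
  have hs : ‖p₃ - q₃‖ ≤ 2 * (1 - ‖p₁‖ ^ 2) := by linarith [norm_sub_le p₃ q₃]
  rw [hE]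
  refine le_trans ?_ (hankel_majorant_le ht ht1 (norm_nonneg p₁) hp1 (norm_nonneg ((p₂ - q₂) / 2)) hd hs)
  generalize (p₂ - q₂) / 2 = d
  generalize p₃ - q₃ = s
  refine (norm_add_le _ _).trans (add_le_add ((norm_sub_le _ _).trans
    (add_le_add ((norm_add_le _ _).trans (add_le_add ?_ ?_)) ?_)) ?_) <;>
    simp [abs_of_pos (show 0 < t by linarith)]

lemma hankel_bound_le {t : ℝ} (ht : (7 + Real.sqrt 401) / 44 < t) :
    8 * t ^ 2 / 3 ≤
      t ^ 2 + t * (2 + t - 11 * t ^ 2) ^ 2 / (3 * (22 * t ^ 2 - 7 * t - 4)) := by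
  have hs := Real.sq_sqrt (by norm_num : (0 : ℝ) ≤ 401)
  have hs0 := Real.sqrt_nonneg 401
  have ht0 : 0 < t := by linarith
  -- The roots are `(7 ± √401)/44`, so the threshold is where the denominator changes sign.
  have hD : 0 < 22 * t ^ 2 - 7 * t - 4 := by
    nlinarith [mul_pos (by linarith : 0 < 44 * t - 7 - √401) (by linarith : 0 < 44 * t - 7 + √401)]
  have : 5 * t ^ 2 / 3 ≤ t * (2 + t - 11 * t ^ 2) ^ 2 / (3 * (22 * t ^ 2 - 7 * t - 4)) := by
    rw [div_le_div_iff₀ (by norm_num) (by positivity)]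
    -- `(2 + t - 11t²)² - 5t(22t² - 7t - 4)` is the perfect square `(11t² - 6t - 2)²`.
    nlinarith [mul_nonneg ht0.le (sq_nonneg (11 * t ^ 2 - 6 * t - 2))]
  linarith

end BiStarlike

theorem mainTheorem3 (t : ℝ) (ht : 1 / 2 < t) (f : ℂ → ℂ)
    (hf : f ∈ BiStarlike.classStarSigma t) :
    (t ≤ (7 + Real.sqrt 401) / 44 →
      ‖BiStarlike.taylorCoeff f 2 * BiStarlike.taylorCoeff f 4
          - BiStarlike.taylorCoeff f 3 ^ 2‖ ≤ 8 * t ^ 2 / 3) ∧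
    ((7 + Real.sqrt 401) / 44 < t → t < 1 →
      ‖BiStarlike.taylorCoeff f 2 * BiStarlike.taylorCoeff f 4
          - BiStarlike.taylorCoeff f 3 ^ 2‖ ≤
        t ^ 2 + t * (2 + t - 11 * t ^ 2) ^ 2 / (3 * (22 * t ^ 2 - 7 * t - 4))) := by
  refine ⟨fun h => BiStarlike.norm_hankel_le ht ?_ hf, fun h h1 =>
    (BiStarlike.norm_hankel_le ht h1.le hf).trans (BiStarlike.hankel_bound_le h)⟩
  -- `(7 + 37)/44 = 1`, so this crude bound yields `t ≤ 1`.
  have : Real.sqrt 401 ≤ 37 := Real.sqrt_le_iff.2 (by norm_num)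
  linarith
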